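/- **Setting.** There are $m\ge 2$ agents and $n$ divisible items. An instance is a matrix $P=(p_{i,j})$ of strictly positive weights ($i\in[m]$, $j\in[n]$). A feasible allocation is a matrix $X=(x_{i,j})$ with $x_{i,j}\in[0,1]$ and $\sum_i x_{i,j}=1$ for every $j$; the load of agent $i$ is $\ell_i(P,X)=\sum_j x_{i,j}p_{i,j}$, the makespan of $X$ is $\max_i \ell_i(P,X)$, and $\ell^{\mathrm{MKS}}(P)$ is the minimum makespan over all feasible allocations. For $\alpha\in\mathbb R$ and $\mathbf w\in\mathbb R_{>0}^m$, the exponentiated proportional allocation $X(P,\alpha,\mathbf w)$ is $$x_{i,j}=\frac{p_{i,j}^{\alpha}\,w_i}{\sum_{i'}p_{i',j}^{\alpha}\,w_{i'}}.$$ The item vectors $\mathbf p_j=(p_{i,j})_{i\in[m]}$ are independent, $\mathbf p_j$ being drawn from a discrete distribution $\mathcal D_j$ on $\mathbb R_{>0}^m$; write $\mathcal D=\prod_j\mathcal D_j$ and $T=\mathbb E_{P\sim\mathcal D}[\ell^{\mathrm{MKS}}(P)]$. For $K\in\mathbb N$ let $\mathrm{NET}'_K(m,\epsilon,\alpha)$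 be the finite set of all $\mathbf w$ with $w_i=\delta_i/u_i^{\alpha}$, where $u_i,\delta_i\in\{(1+\epsilon)^r : r\in\{1,\dots,K\}\}$ for all $i$. **Theorem.** There are a negative exponentiation constant $\alpha=\alpha(m,\epsilon)$, depending only on $m$ and $\epsilon$, and an absolute constant $C_{\mathrm{net}}>0$ such that the following holds. For every $c>0$ there is $C_{\mathrm{err}}>0$ (depending only on $c$), and for every $b\in\mathbb N$ there is $C_{\mathrm{smp}}>0$ (depending only on $c$ and $b$), such that for all $m\ge2$ and $0<\epsilon<1$ there is a number of samples $$H\le C_{\mathrm{smp}}\cdot\frac{m}{\log m}\cdot\log\frac m\epsilon$$ with this property: for every $n$ there is a learning algorithm (a map, not depending on $\mathcal D$, from $H$ sampled instances to parameter vectors) whose output $\tilde{\mathbf w}$ always lies in $\mathrm{NET}'_K(m,\epsilon,\alpha)$ with $K=\lfloor C_{\mathrm{net}}\cdot\frac m\epsilon\log\frac m\epsilon\rfloor$, and such that for every $\mathcal D$ as above satisfying the small items assumption $$p_{i,j}\le \frac{T}{\zeta}\quad\text{for all } i,j \text{ and all } P \text{ in the support of } \mathcal D,\qquad \zeta=c\cdot\frac{\log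 m}{\epsilon^2},$$ with probability at least $1-(\epsilon/m)^{bm}$ over $H$ independent instances drawn from $\mathcal D$, the output $\tilde{\mathbf w}$ satisfies $$\mathbb E_{P\sim\mathcal D}\Big[\max_{i\in[m]}\ell_i\big(P,X(P,\alpha,\tilde{\mathbf w})\big)\Big]\le(1+C_{\mathrm{err}}\,\epsilon)\cdot T.$$ -/

import Mathlib

open MeasureTheory

noncomputable section

namespace OnlineAllocation

/-- A weight matrix for `m` agents and `n` items, stored by items:
`P j i` is the weight `p_{i,j}` of item `j` for agent `i`, so `P j` is the vector `𝐩_j`. -/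
abbrev WeightMatrix (m n : ℕ) : Type := Fin n → Fin m → ℝ

/-- A (fractional) assignment, stored by items: `X j i` is the fraction `x_{i,j}`. -/
abbrev Assignment (m n : ℕ) : Type := Fin n → Fin m → ℝ

/-- Feasible assignments: fractions in `[0,1]`, and every item is fully allocated. -/
def feasible (m n : ℕ) : Set (Assignment m n) :=
  {X | (∀ j i, X j i ∈ Set.Icc (0 : ℝ) 1) ∧ ∀ j, ∑ i, X j i = 1}

/-- The load `ℓ_i(P, X) = ∑_j x_{i,j} p_{i,j}` of agent `i`. -/
def load {m n : ℕ} (P : WeightMatrix m n) (X : Assignment m n) (i : Fin m) : ℝ :=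
  ∑ j, X j i * P j i

/-- The makespan (maximum load over the agents) of an assignment. -/
def makespan {m n : ℕ} (P : WeightMatrix m n) (X : Assignment m n) : ℝ :=
  ⨆ i, load P X i

/-- The optimal makespan: the least `t` such that some feasible assignment
has all loads at most `t`. -/
def optMakespan {m n : ℕ} (P : WeightMatrix m n) : ℝ :=
  sInf {t | ∃ X ∈ feasible m n, ∀ i, load P X i ≤ t}

/-- The exponentiated proportional allocation with exponentiation constant `α`
and parameters `w`: `x_{i,j} = p_{i,j}^α w_i / ∑_{i'} p_{i',j}^α w_{i'}`. -/
def epAllocation {m n : ℕ} (P : WeightMatrix m n) (α : ℝ) (w : Fin m → ℝ) : Assignment m n :=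
  fun j i => P j i ^ α * w i / ∑ i', P j i' ^ α * w i'

/-- The net of parameter vectors `w_i = δ_i / u_i^α` where all `u_i` and `δ_i`
are of the form `(1 + ε)^r` with `r ∈ {1, …, K}`. -/
def net (m : ℕ) (ε α : ℝ) (K : ℕ) : Set (Fin m → ℝ) :=
  {w | ∃ u δ : Fin m → ℝ,
    (∀ i, ∃ r ∈ Finset.Icc 1 K, u i = (1 + ε) ^ r) ∧
    (∀ i, ∃ r ∈ Finset.Icc 1 K, δ i = (1 + ε) ^ r) ∧
    ∀ i, w i = δ i / u i ^ α}

/-- The law of a random instance: the item vectors are drawn independently, item `j` from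
the discrete distribution `D j`. -/
def instanceLaw {m n : ℕ} (D : Fin n → PMF (Fin m → ℝ)) : Measure (WeightMatrix m n) :=
  Measure.pi fun j => (D j).toMeasure

/-- The law of `H` independent random instances. -/
def sampleLaw {m n : ℕ} (D : Fin n → PMF (Fin m → ℝ)) (H : ℕ) :
    Measure (Fin H → WeightMatrix m n) :=
  Measure.pi fun _ => Measure.pi fun j => (D j).toMeasure

/-- The expected optimal makespan of a random instance. -/
def expOpt {m n : ℕ} (D : Fin n → PMF (Fin m → ℝ)) : ℝ :=
  ∫ P, optMakespan P ∂(instanceLaw D)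

/-- The expected makespan, over a fresh random instance, of the exponentiated proportional
allocation with exponentiation constant `α` and fixed parameters `w`. -/
def expMakespan {m n : ℕ} (D : Fin n → PMF (Fin m → ℝ)) (α : ℝ) (w : Fin m → ℝ) : ℝ :=
  ∫ P, makespan P (epAllocation P α w) ∂(instanceLaw D)

/-- All weights that occur with positive probability are strictly positive. -/
def PositiveWeights {m n : ℕ} (D : Fin n → PMF (Fin m → ℝ)) : Prop :=
  ∀ j, ∀ p ∈ (D j).support, ∀ i, 0 < p i

/-- Small items: no weight that occurs with positive probability exceeds a `1 / ζ` fraction of the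
expected optimal makespan. -/
def SmallItems {m n : ℕ} (D : Fin n → PMF (Fin m → ℝ)) (ζ : ℝ) : Prop :=
  ∀ j, ∀ p ∈ (D j).support, ∀ i, p i ≤ expOpt D / ζ

end OnlineAllocation

end

open MeasureTheory

noncomputable section

namespace OnlineAllocation

/-! Take α = -(g+1) with (1+ε)^g ≥ m/ε. For w_i = y_i^{-(g+1)} an item is shared in proportion to
(y_i p_i)^{-(g+1)}, so its y-weighted cost is nearly the minimum of y_l p_l, which every feasible
allocation pays. Hence the y-weighted average load is at most (1+2ε) times the optimum
(`sum_mul_load_le`), an approximate form of LP duality.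

To bound every expected load (`exists_levels`), let w_i = (1+ε)^{t_i}, start all levels t_i at the
top and lower overloaded agents. Lowering one level divides that agent's load by at most 1+ε and
decreases no other load, so every agent below the top keeps load at least B, a little above the
average bound. If a level came near the bottom, some long window would contain no level
(`exists_gap`). The agents beneath it would carry almost all of the weight y and have loads at least
B, contradicting the average bound. So the descent stops within a bounded range, and
`exists_netPoint_eq` finds its endpoint in the net.

The learner minimizes the maximal empirical load over the net. Exponential moments at rate ε/M,
where M = T/ζ bounds the weights, give failure exponent c·log m per sample, and H beats the union
bound over the net (`measureReal_minimizer_le`, `union_bound_le`). The same moments pass from the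
maximum of the expected loads to the expected maximum at additive cost εT/c (`integral_iSup_le`). -/

/-! ### Monotonicity of the shares in the parameters -/

/-- The fraction of an item with weight vector `p` that the exponentiated proportional
allocation gives to agent `i`. -/
def epShare {m : ℕ} (α : ℝ) (w p : Fin m → ℝ) (i : Fin m) : ℝ :=
  p i ^ α * w i / ∑ i', p i' ^ α * w i'

theorem load_epAllocation {m n : ℕ} (P : WeightMatrix m n) (α : ℝ) (w : Fin m → ℝ) (i : Fin m) :
    load P (epAllocation P α w) i = ∑ j, epShare α w (P j) i * P j i := rfl

theorem epShare_nonneg {m : ℕ} {α : ℝ} {w p : Fin m → ℝ} (hw : ∀ i, 0 ≤ w i)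
    (hp : ∀ i, 0 < p i) (i : Fin m) : 0 ≤ epShare α w p i :=
  div_nonneg (mul_nonneg (Real.rpow_nonneg (hp i).le _) (hw i))
    (Finset.sum_nonneg fun l _ => mul_nonneg (Real.rpow_nonneg (hp l).le _) (hw l))

theorem epShare_le_one {m : ℕ} {α : ℝ} {w p : Fin m → ℝ} (hw : ∀ i, 0 ≤ w i)
    (hp : ∀ i, 0 < p i) (i : Fin m) : epShare α w p i ≤ 1 :=
  div_le_one_of_le₀
    (Finset.single_le_sum (f := fun l => p l ^ α * w l)
      (fun l _ => mul_nonneg (Real.rpow_nonneg (hp l).le _) (hw l)) (Finset.mem_univ i))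
    (Finset.sum_nonneg fun l _ => mul_nonneg (Real.rpow_nonneg (hp l).le _) (hw l))

/-- Lowering the parameter of one agent does not decrease the shares of the others. -/
theorem epShare_le_update_of_ne {m : ℕ} {α : ℝ} {w p : Fin m → ℝ} (hw : ∀ i, 0 < w i)
    (hp : ∀ i, 0 < p i) {i l : Fin m} (hl : l ≠ i) {a : ℝ} (ha : 0 < a) (hai : a ≤ w i) :
    epShare α w p l ≤ epShare α (Function.update w i a) p l := by
  unfold epShare
  have hpos : ∀ l, 0 < Function.update w i a l := by
    intro l
    by_cases h : l = i
    · subst h; simpa using ha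
    · simpa [h] using hw l
  rw [Function.update_of_ne hl]
  refine div_le_div_of_nonneg_left (mul_nonneg (Real.rpow_nonneg (hp l).le _) (hw l).le)
    (Finset.sum_pos (fun l _ => mul_pos (Real.rpow_pos_of_pos (hp l) _) (hpos l)) ⟨i, by simp⟩) ?_
  refine Finset.sum_le_sum fun l _ => mul_le_mul_of_nonneg_left ?_ (Real.rpow_nonneg (hp l).le _)
  by_cases h : l = i
  · subst h; simpa using hai
  · simp [h]

/-- Lowering the parameter of an agent by a factor `r` lowers its share by at most `r`. -/
theorem epShare_div_le_update {m : ℕ} {α : ℝ} {w p : Fin m → ℝ} (hw : ∀ i, 0 < w i)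
    (hp : ∀ i, 0 < p i) (i : Fin m) {r : ℝ} (hr : 1 ≤ r) :
    epShare α w p i / r ≤ epShare α (Function.update w i (w i / r)) p i := by
  have hr0 : 0 < r := by linarith
  have ha : w i / r ≤ w i := div_le_self (hw i).le hr
  have hpos : ∀ l, 0 < Function.update w i (w i / r) l := by
    intro l
    by_cases h : l = i
    · subst h; simpa using div_pos (hw l) hr0
    · simpa [h] using hw l
  unfold epShare
  rw [Function.update_self, div_right_comm, mul_div_assoc]
  refine div_le_div_of_nonneg_left (mul_nonneg (Real.rpow_nonneg (hp i).le _)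
      (div_pos (hw i) hr0).le)
    (Finset.sum_pos (fun l _ => mul_pos (Real.rpow_pos_of_pos (hp l) _) (hpos l)) ⟨i, by simp⟩) ?_
  refine Finset.sum_le_sum fun l _ => mul_le_mul_of_nonneg_left ?_ (Real.rpow_nonneg (hp l).le _)
  by_cases h : l = i
  · subst h; simpa using ha
  · simp [h]

/-! ### Soft minimum and duality for one instance -/

/-- The mean of positive numbers with weights proportional to their `-(g + 1)`-st powers is close
to their minimum. -/
theorem sum_mul_inv_pow_le {m g : ℕ} {ε : ℝ} (hε : 0 < ε) (hg : (m : ℝ) ≤ ε * (1 + ε) ^ g)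
    {q : Fin m → ℝ} (hq : ∀ i, 0 < q i) (l : Fin m) :
    ∑ i, q i * (q i)⁻¹ ^ (g + 1) ≤ (1 + 2 * ε) * q l * ∑ i, (q i)⁻¹ ^ (g + 1) := by
  have hm : (0 : ℝ) < m := by exact_mod_cast Fin.pos l
  have hpow : 0 < (1 + ε) ^ g := by positivity
  have hterm : ∀ i, q i * (q i)⁻¹ ^ (g + 1) ≤
      (1 + ε) * q l * (q i)⁻¹ ^ (g + 1) + ε / m * (q l * (q l)⁻¹ ^ (g + 1)) := by
    intro i
    have h0 : 0 < (q i)⁻¹ ^ (g + 1) := pow_pos (inv_pos.2 (hq i)) _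
    have h1 : 0 < q l * (q l)⁻¹ ^ (g + 1) := mul_pos (hq l) (pow_pos (inv_pos.2 (hq l)) _)
    -- Either q i is nearly as small as q l, or its weight is suppressed: one of the g + 1 powers
    -- cancels the factor q i and the other g gain (1+ε)^{-g} ≤ ε/m.
    rcases le_total (q i) ((1 + ε) * q l) with h | h
    · have := mul_le_mul_of_nonneg_right h h0.le
      have : 0 ≤ ε / m * (q l * (q l)⁻¹ ^ (g + 1)) := by positivity
      linarith
    · have e : ∀ i, q i * (q i)⁻¹ ^ (g + 1) = (q i)⁻¹ ^ g := by
        intro i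
        rw [pow_succ', ← mul_assoc, mul_inv_cancel₀ (hq i).ne', one_mul]
      have hl := hq l
      have h2 : (q i)⁻¹ ^ g ≤ ((1 + ε) * q l)⁻¹ ^ g :=
        pow_le_pow_left₀ (inv_pos.2 (hq i)).le (inv_anti₀ (by positivity) h) _
      have h3 : ((1 + ε) * q l)⁻¹ ^ g = ((1 + ε) ^ g)⁻¹ * (q l)⁻¹ ^ g := by
        rw [mul_inv, mul_pow, inv_pow]
      have h4 : ((1 + ε) ^ g)⁻¹ ≤ ε / m := by
        rw [inv_le_iff_one_le_mul₀ hpow, div_mul_eq_mul_div, one_le_div hm]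
        exact hg
      have h5 : 0 < (q l)⁻¹ ^ g := pow_pos (inv_pos.2 hl) _
      have h6 : 0 ≤ (1 + ε) * q l * (q i)⁻¹ ^ (g + 1) := by positivity
      rw [e i, e l]
      have := mul_le_mul_of_nonneg_right h4 h5.le
      linarith
  have hS : (q l)⁻¹ ^ (g + 1) ≤ ∑ i, (q i)⁻¹ ^ (g + 1) :=
    Finset.single_le_sum (f := fun i => (q i)⁻¹ ^ (g + 1))
      (fun i _ => (pow_pos (inv_pos.2 (hq i)) _).le) (Finset.mem_univ l)
  have h := Finset.sum_le_sum fun i (_ : i ∈ Finset.univ) => hterm i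
  rw [Finset.sum_add_distrib, ← Finset.mul_sum, Finset.sum_const, Finset.card_univ,
    Fintype.card_fin, nsmul_eq_mul, ← mul_assoc (m : ℝ), mul_div_cancel₀ _ hm.ne'] at h
  have := mul_le_mul_of_nonneg_left hS (mul_pos hε (hq l)).le
  nlinarith

theorem rpow_neg_mul_eq_inv_pow {k : ℕ} {p y : ℝ} (hp : 0 < p) :
    p ^ (-(k : ℝ)) * (y⁻¹) ^ k = (y * p)⁻¹ ^ k := by
  rw [Real.rpow_neg hp.le, Real.rpow_natCast, mul_inv, mul_pow, inv_pow p, mul_comm]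

/-- For parameters `w i = (y i)⁻¹ ^ (g + 1)`, the loads averaged with the weights `y` are almost
optimal. -/
theorem sum_mul_load_le {m n g : ℕ} {ε : ℝ} (hm : 0 < m) (hε : 0 < ε)
    (hg : (m : ℝ) ≤ ε * (1 + ε) ^ g)
    {P : WeightMatrix m n} (hP : ∀ j i, 0 < P j i) {y : Fin m → ℝ} (hy : ∀ i, 0 < y i) :
    ∑ i, y i * load P (epAllocation P (-((g + 1 : ℕ) : ℝ)) fun i => (y i)⁻¹ ^ (g + 1)) i ≤
      (1 + 2 * ε) * (∑ i, y i) * optMakespan P := by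
  have hy0 : 0 < ∑ i, y i := Finset.sum_pos (fun i _ => hy i) ⟨⟨0, hm⟩, by simp⟩
  have hc : 0 < (1 + 2 * ε) * ∑ i, y i := by positivity
  rw [← div_le_iff₀' hc]
  refine le_csInf ?_ ?_
  · refine ⟨∑ i, load P (fun _ _ => 1 / (m : ℝ)) i, fun _ _ => 1 / (m : ℝ), ⟨?_, ?_⟩, ?_⟩
    · intro j i
      refine ⟨by positivity, ?_⟩
      rw [div_le_one (by exact_mod_cast hm)]
      exact_mod_cast hm
    · intro j
      have : (m : ℝ) ≠ 0 := by exact_mod_cast hm.ne'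
      simp [this]
    · intro i
      refine Finset.single_le_sum (f := fun i => load P (fun _ _ => 1 / (m : ℝ)) i)
        (fun i _ => Finset.sum_nonneg fun j _ => mul_nonneg (by positivity) (hP j i).le)
        (Finset.mem_univ i)
  · rintro t ⟨X, ⟨hX0, hX1⟩, hXt⟩
    rw [div_le_iff₀' hc]
    have hitem : ∀ j, ∑ i, y i * (epShare (-((g + 1 : ℕ) : ℝ)) (fun i => (y i)⁻¹ ^ (g + 1)) (P j) i
        * P j i) ≤ (1 + 2 * ε) * ∑ i, y i * (X j i * P j i) := by
      intro j
      have hq : ∀ i, 0 < y i * P j i := fun i => mul_pos (hy i) (hP j i)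
      set Q := ∑ i, (y i * P j i)⁻¹ ^ (g + 1) with hQ
      have hQ0 : 0 < Q :=
        Finset.sum_pos (fun i _ => pow_pos (inv_pos.2 (hq i)) _) ⟨⟨0, hm⟩, by simp⟩
      set R := ∑ i, (y i * P j i) * (y i * P j i)⁻¹ ^ (g + 1) with hR
      have hl : ∀ l, R / Q ≤ (1 + 2 * ε) * (y l * P j l) := fun l => by
        rw [div_le_iff₀ hQ0]
        exact sum_mul_inv_pow_le hε hg hq l
      have e1 : ∑ i, y i * (epShare (-((g + 1 : ℕ) : ℝ)) (fun i => (y i)⁻¹ ^ (g + 1)) (P j) i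
          * P j i) = R / Q := by
        rw [hR, Finset.sum_div]
        refine Finset.sum_congr rfl fun i _ => ?_
        unfold epShare
        simp only [rpow_neg_mul_eq_inv_pow (hP j _)]
        rw [← hQ]
        ring
      rw [e1]
      -- R / Q is below (1+2ε) times every y l * P j l, hence below their average with weights X j
      -- l.
      calc R / Q = ∑ l, X j l * (R / Q) := by rw [← Finset.sum_mul, hX1 j, one_mul]
        _ ≤ ∑ l, X j l * ((1 + 2 * ε) * (y l * P j l)) :=
            Finset.sum_le_sum fun l _ => mul_le_mul_of_nonneg_left (hl l) (hX0 j l).1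
        _ = _ := by
            rw [Finset.mul_sum]
            exact Finset.sum_congr rfl fun l _ => by ring
    calc _ = ∑ j, ∑ i, y i * (epShare (-((g + 1 : ℕ) : ℝ)) (fun i => (y i)⁻¹ ^ (g + 1)) (P j) i
        * P j i) := by
          simp only [load_epAllocation, Finset.mul_sum]
          exact Finset.sum_comm
      _ ≤ ∑ j, (1 + 2 * ε) * ∑ i, y i * (X j i * P j i) := Finset.sum_le_sum fun j _ => hitem j
      _ = (1 + 2 * ε) * ∑ i, y i * load P X i := by
          rw [← Finset.mul_sum, Finset.sum_comm]
          simp only [load, Finset.mul_sum]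
      _ ≤ (1 + 2 * ε) * ∑ i, y i * t := by
          refine mul_le_mul_of_nonneg_left (Finset.sum_le_sum fun i _ => ?_) (by positivity)
          exact mul_le_mul_of_nonneg_left (hXt i) (hy i).le
      _ = _ := by rw [← Finset.sum_mul]; ring

theorem optMakespan_nonneg {m n : ℕ} (hm : 0 < m) {P : WeightMatrix m n}
    (hP : ∀ j i, 0 < P j i) : 0 ≤ optMakespan P := by
  refine Real.sInf_nonneg ?_
  rintro t ⟨X, ⟨hX0, -⟩, hXt⟩
  exact (Finset.sum_nonneg fun j _ => mul_nonneg (hX0 j ⟨0, hm⟩).1 (hP j _).le).trans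
    (hXt ⟨0, hm⟩)

/-! ### A pigeonhole lemma for levels -/

/-- If one of `m` natural numbers exceeds `m * G`, some window of length `G` contains none. -/
theorem exists_gap {m G : ℕ} {f : Fin m → ℕ} {a : Fin m} (ha : m * G < f a) :
    ∃ s, s + G < f a ∧ ∀ i, f i ≤ s ∨ s + G < f i := by
  by_contra! hcon
  -- Otherwise the m disjoint windows (jG, jG+G] each contain a value. They use up all indices,
  -- including a, so f a ≤ m * G.
  have key : ∀ j : Fin m, ∃ i, j * G < f i ∧ f i ≤ j * G + G := by
    intro j
    have : (j + 1) * G ≤ m * G := Nat.mul_le_mul_right _ j.2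
    exact hcon (j * G) (by linarith)
  choose σ h1 h2 using key
  have hinj : Function.Injective σ := by
    have hlt : ∀ j l, j < l → σ j ≠ σ l := by
      intro j l hjl e
      have h3 : ((j : ℕ) + 1) * G ≤ l * G := Nat.mul_le_mul_right _ hjl
      have h4 := h2 j
      have h5 := h1 l
      rw [e] at h4
      linarith
    intro j l e
    rcases lt_trichotomy j l with h | h | h
    · exact absurd e (hlt _ _ h)
    · exact h
    · exact absurd e.symm (hlt _ _ h)
  obtain ⟨j, rfl⟩ := Finite.surjective_of_injective hinj a
  have : (j + 1) * G ≤ m * G := Nat.mul_le_mul_right _ j.2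
  have := h2 j
  linarith

/-! ### Exponential moments of sums and maxima -/

/-- On [0, M] the convex function exp(s·) lies below its chord, so only the mean of f enters; then 1
+ x ≤ exp x. Either sign of s is allowed, which serves both tails. -/
theorem integral_exp_mul_le {Ω : Type*} [MeasurableSpace Ω] {ν : Measure Ω}
    [IsProbabilityMeasure ν] {f : Ω → ℝ} {M : ℝ} (hM : 0 < M) (hf : Measurable f)
    (h : ∀ᵐ x ∂ν, 0 ≤ f x ∧ f x ≤ M) (s : ℝ) :
    ∫ x, Real.exp (s * f x) ∂ν ≤ Real.exp ((Real.exp (s * M) - 1) / M * ∫ x, f x ∂ν) := by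
  have hint : Integrable f ν := by
    refine Integrable.of_bound hf.aestronglyMeasurable M ?_
    filter_upwards [h] with x hx
    rw [Real.norm_eq_abs, abs_of_nonneg hx.1]
    exact hx.2
  calc ∫ x, Real.exp (s * f x) ∂ν
      ≤ ∫ x, (1 + (Real.exp (s * M) - 1) / M * f x) ∂ν := by
        refine integral_mono_of_nonneg (Filter.Eventually.of_forall fun x => (Real.exp_pos _).le)
          ((integrable_const _).add (hint.const_mul _)) ?_
        filter_upwards [h] with x hx
        have h1 : 0 ≤ f x / M := div_nonneg hx.1 hM.le
        have h2 : f x / M ≤ 1 := div_le_one_of_le₀ hx.2 hM.le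
        have := convexOn_exp.2 (Set.mem_univ 0) (Set.mem_univ (s * M)) (sub_nonneg.2 h2) h1
          (by ring)
        simp only [smul_eq_mul, mul_zero, zero_add, Real.exp_zero, mul_one] at this
        have e : f x / M * (s * M) = s * f x := by field_simp
        rw [e] at this
        refine this.trans (le_of_eq ?_)
        ring
    _ = 1 + (Real.exp (s * M) - 1) / M * ∫ x, f x ∂ν := by
        rw [integral_add (integrable_const _) (hint.const_mul _), integral_const_mul]
        simp
    _ ≤ _ := by linarith [Real.add_one_le_exp ((Real.exp (s * M) - 1) / M * ∫ x, f x ∂ν)]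

theorem integral_exp_sum_eval_le {ι X : Type*} [Fintype ι] [MeasurableSpace X]
    {ν : ι → Measure X} [∀ j, IsProbabilityMeasure (ν j)] {f : X → ℝ} {M : ℝ} (hM : 0 < M)
    (hf : Measurable f) (h : ∀ j, ∀ᵐ x ∂ν j, 0 ≤ f x ∧ f x ≤ M) (s : ℝ) :
    ∫ P, Real.exp (s * ∑ j, f (P j)) ∂(Measure.pi ν) ≤
      Real.exp ((Real.exp (s * M) - 1) / M * ∫ P, ∑ j, f (P j) ∂(Measure.pi ν)) := by
  have hint : ∀ j, Integrable f (ν j) := by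
    intro j
    refine Integrable.of_bound hf.aestronglyMeasurable M ?_
    filter_upwards [h j] with x hx
    rw [Real.norm_eq_abs, abs_of_nonneg hx.1]
    exact hx.2
  rw [integral_finsetSum _ fun j _ => integrable_comp_eval (hint j)]
  have heval : ∀ j, ∫ P, f (P j) ∂(Measure.pi ν) = ∫ x, f x ∂ν j := fun j =>
    integral_comp_eval hf.aestronglyMeasurable
  simp only [heval, Finset.mul_sum, Real.exp_sum]
  rw [integral_fintype_prod_eq_prod fun _ x => Real.exp (s * f x)]
  exact Finset.prod_le_prod (fun j _ => integral_nonneg fun x => (Real.exp_pos _).le)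
    fun j _ => integral_exp_mul_le hM hf (h j) s

/-- The maximum of finitely many random variables with controlled exponential moments exceeds
their means by little. -/
theorem integral_iSup_le {Ω : Type*} [MeasurableSpace Ω] {ν : Measure Ω}
    [IsProbabilityMeasure ν] {m : ℕ} (hm : 0 < m) {F : Fin m → Ω → ℝ} {B t : ℝ} (ht : 0 < t)
    (h0 : ∀ᵐ x ∂ν, ∀ i, 0 ≤ F i x) (hint : ∀ i, Integrable (fun x => Real.exp (t * F i x)) ν)
    (hexp : ∀ i, ∫ x, Real.exp (t * F i x) ∂ν ≤ Real.exp (t * B)) :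
    ∫ x, ⨆ i, F i x ∂ν ≤ Real.log m / t + B := by
  have : Nonempty (Fin m) := ⟨⟨0, hm⟩⟩
  have hm' : (0 : ℝ) < m := by exact_mod_cast hm
  -- The tangent bound t·F ≤ a - 1 + exp(t·F - a) replaces Jensen; this a makes the expected sum of
  -- the exponentials at most exp a.
  set a := Real.log m + t * B with ha
  have hea : Real.exp a = m * Real.exp (t * B) := by rw [ha, Real.exp_add, Real.exp_log hm']
  have hint' : Integrable (fun x => ∑ i, Real.exp (t * F i x)) ν :=
    integrable_finsetSum _ fun i _ => hint i
  have hle : ∫ x, ⨆ i, F i x ∂ν ≤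
      ∫ x, (a - 1) / t + (t * Real.exp a)⁻¹ * ∑ i, Real.exp (t * F i x) ∂ν := by
    refine integral_mono_of_nonneg ?_ ((integrable_const _).add (hint'.const_mul _)) ?_
    · filter_upwards [h0] with x hx
      exact Real.iSup_nonneg hx
    · refine Filter.Eventually.of_forall fun x => ciSup_le fun i => ?_
      have h1 : Real.exp (t * F i x) ≤ ∑ i, Real.exp (t * F i x) :=
        Finset.single_le_sum (f := fun i => Real.exp (t * F i x))
          (fun i _ => (Real.exp_pos _).le) (Finset.mem_univ i)
      have h2 := Real.add_one_le_exp (t * F i x - a)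
      rw [Real.exp_sub] at h2
      have h3 := div_le_div_of_nonneg_right h1 (Real.exp_pos a).le
      have h4 : (a - 1) / t + (t * Real.exp a)⁻¹ * ∑ i, Real.exp (t * F i x) =
          (a - 1 + (∑ i, Real.exp (t * F i x)) / Real.exp a) / t := by field_simp
      change F i x ≤ (a - 1) / t + (t * Real.exp a)⁻¹ * ∑ i, Real.exp (t * F i x)
      rw [h4, le_div_iff₀ ht]
      linarith
  have hsum : ∫ x, ∑ i, Real.exp (t * F i x) ∂ν ≤ Real.exp a := by
    rw [integral_finsetSum _ fun i _ => hint i, hea]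
    refine (Finset.sum_le_sum fun i _ => hexp i).trans (le_of_eq ?_)
    simp
  rw [integral_add (integrable_const _) (hint'.const_mul _), integral_const_mul] at hle
  simp only [integral_const, probReal_univ, one_smul] at hle
  have h6 := mul_le_mul_of_nonneg_left hsum
    (inv_nonneg.2 (mul_pos ht (Real.exp_pos a)).le)
  have h7 : (t * Real.exp a)⁻¹ * Real.exp a = 1 / t := by
    have := Real.exp_pos a
    field_simp
  have h8 : (a - 1) / t + 1 / t = Real.log m / t + B := by
    rw [ha]; field_simp; ring
  linarith

/-! ### Chernoff bounds and empirical minimization -/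

section Sampling

variable {Ω : Type*} [MeasurableSpace Ω] {ν : Measure Ω} [IsProbabilityMeasure ν]

theorem integrable_exp_mul_of_bound {Ω : Type*} [MeasurableSpace Ω] {ν : Measure Ω}
    [IsFiniteMeasure ν] {f : Ω → ℝ} {C : ℝ} (hf : Measurable f) (h : ∀ᵐ x ∂ν, |f x| ≤ C) (t : ℝ) :
    Integrable (fun x => Real.exp (t * f x)) ν := by
  refine Integrable.of_bound (by fun_prop) (Real.exp (|t| * C)) ?_
  filter_upwards [h] with x hx
  rw [Real.norm_eq_abs, Real.abs_exp, Real.exp_le_exp]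
  calc t * f x ≤ |t * f x| := le_abs_self _
    _ = |t| * |f x| := abs_mul _ _
    _ ≤ |t| * C := mul_le_mul_of_nonneg_left hx (abs_nonneg t)

theorem ae_pi_abs_sum_le {f : Ω → ℝ} {C : ℝ} (h : ∀ᵐ x ∂ν, |f x| ≤ C) (H : ℕ) :
    ∀ᵐ S ∂(Measure.pi fun _ : Fin H => ν), |∑ l, f (S l)| ≤ H * C := by
  have h' : ∀ᵐ S ∂(Measure.pi fun _ : Fin H => ν), ∀ l, |f (S l)| ≤ C :=
    ae_all_iff.2 fun l =>
      (measurePreserving_eval (fun _ : Fin H => ν) l).quasiMeasurePreserving.ae h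
  filter_upwards [h'] with S hS
  refine (Finset.abs_sum_le_sum_abs _ _).trans ((Finset.sum_le_sum fun l _ => hS l).trans ?_)
  simp

theorem mgf_sum_eval (f : Ω → ℝ) (H : ℕ) (t : ℝ) :
    ProbabilityTheory.mgf (fun S : Fin H → Ω => ∑ l, f (S l)) (Measure.pi fun _ => ν) t =
      (∫ x, Real.exp (t * f x) ∂ν) ^ H := by
  unfold ProbabilityTheory.mgf
  simp only [Finset.mul_sum, Real.exp_sum]
  rw [integral_fintype_prod_eq_pow fun x => Real.exp (t * f x), Fintype.card_fin]

/-- Chernoff's bound with μ tied to f only through the exponential moment. C serves integrability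
alone and does not enter the estimate. -/
theorem measureReal_le_sum_eval_le {f : Ω → ℝ} {C t μ τ : ℝ} (hf : Measurable f)
    (h : ∀ᵐ x ∂ν, |f x| ≤ C) (ht : 0 < t)
    (hexp : ∫ x, Real.exp (t * f x) ∂ν ≤ Real.exp (t * μ)) (H : ℕ) :
    (Measure.pi fun _ : Fin H => ν).real {S | H * (μ + τ) ≤ ∑ l, f (S l)} ≤
      Real.exp (-(H * (t * τ))) := by
  refine (ProbabilityTheory.measure_ge_le_exp_mul_mgf _ ht.le
    (integrable_exp_mul_of_bound (by fun_prop) (ae_pi_abs_sum_le h H) t)).trans ?_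
  rw [mgf_sum_eval]
  refine (mul_le_mul_of_nonneg_left (pow_le_pow_left₀
    (integral_nonneg fun x => (Real.exp_pos _).le) hexp H) (Real.exp_pos _).le).trans ?_
  rw [← Real.exp_nat_mul, ← Real.exp_add]
  exact Real.exp_le_exp.2 (le_of_eq (by ring))

theorem measureReal_sum_eval_le_le {f : Ω → ℝ} {C t μ τ A : ℝ} (hf : Measurable f)
    (h : ∀ᵐ x ∂ν, |f x| ≤ C) (ht : 0 < t) (hA : A + τ ≤ μ)
    (hexp : ∫ x, Real.exp (-t * f x) ∂ν ≤ Real.exp (-t * μ)) (H : ℕ) :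
    (Measure.pi fun _ : Fin H => ν).real {S | ∑ l, f (S l) ≤ H * A} ≤
      Real.exp (-(H * (t * τ))) := by
  refine (ProbabilityTheory.measure_le_le_exp_mul_mgf _ (neg_nonpos.2 ht.le)
    (integrable_exp_mul_of_bound (by fun_prop) (ae_pi_abs_sum_le h H) (-t))).trans ?_
  rw [mgf_sum_eval]
  refine (mul_le_mul_of_nonneg_left (pow_le_pow_left₀
    (integral_nonneg fun x => (Real.exp_pos _).le) hexp H) (Real.exp_pos _).le).trans ?_
  rw [← Real.exp_nat_mul, ← Real.exp_add]
  refine Real.exp_le_exp.2 ?_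
  have := mul_le_mul_of_nonneg_left hA (mul_nonneg (Nat.cast_nonneg H) ht.le)
  linarith

/-- Minimizing the maximal empirical mean over finitely many parameters yields, with high
probability, a parameter whose true means are almost as small as those of any other. -/
theorem measureReal_minimizer_le {Θ ι : Type*} [Fintype Θ] [Fintype ι] {F : Θ → ι → Ω → ℝ}
    {μ : Θ → ι → ℝ} {C t ε τ B : ℝ} {H : ℕ} (hε : 0 < ε) (ht : 0 < t)
    (hF : ∀ θ i, Measurable (F θ i)) (hb : ∀ θ i, ∀ᵐ x ∂ν, |F θ i x| ≤ C)
    (hup : ∀ θ i, ∫ x, Real.exp (t * F θ i x) ∂ν ≤ Real.exp (t * ((1 + ε) * μ θ i)))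
    (hlo : ∀ θ i, ∫ x, Real.exp (-t * F θ i x) ∂ν ≤ Real.exp (-t * (μ θ i / (1 + ε))))
    {θ₀ : Θ} (hθ₀ : ∀ i, μ θ₀ i ≤ B) {est : (Fin H → Ω) → Θ}
    (hest : ∀ S θ i, ∃ j, ∑ l, F (est S) i (S l) ≤ ∑ l, F θ j (S l)) :
    (Measure.pi fun _ : Fin H => ν).real
        {S | ∃ i, (1 + ε) * ((1 + ε) * B + τ + τ) < μ (est S) i} ≤
      (Fintype.card ι * (1 + Fintype.card Θ)) * Real.exp (-(H * (t * τ))) := by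
  set A := (1 + ε) * B + τ with hA
  have hε1 : 0 < 1 + ε := by linarith
  -- Failure means that the good θ₀ looks bad on the samples, or that some bad parameter looks good.
  have hsub : {S | ∃ i, (1 + ε) * (A + τ) < μ (est S) i} ⊆
      (⋃ i, {S : Fin H → Ω | H * ((1 + ε) * μ θ₀ i + τ) ≤ ∑ l, F θ₀ i (S l)}) ∪
      ⋃ p : Θ × ι, {S : Fin H → Ω | (1 + ε) * (A + τ) < μ p.1 p.2 ∧
        ∑ l, F p.1 p.2 (S l) ≤ H * A} := by
    rintro S ⟨i, hi⟩
    by_cases hS : ∑ l, F (est S) i (S l) ≤ H * A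
    · exact Or.inr (Set.mem_iUnion.2 ⟨(est S, i), hi, hS⟩)
    · obtain ⟨j, hj⟩ := hest S θ₀ i
      refine Or.inl (Set.mem_iUnion.2 ⟨j, ?_⟩)
      refine le_trans ?_ ((not_le.1 hS).le.trans hj)
      refine mul_le_mul_of_nonneg_left ?_ (Nat.cast_nonneg H)
      linarith [mul_le_mul_of_nonneg_left (hθ₀ j) hε1.le]
  refine (measureReal_mono hsub).trans ((measureReal_union_le _ _).trans ?_)
  have h1 : (Measure.pi fun _ : Fin H => ν).real
      (⋃ i, {S : Fin H → Ω | H * ((1 + ε) * μ θ₀ i + τ) ≤ ∑ l, F θ₀ i (S l)}) ≤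
      Fintype.card ι * Real.exp (-(H * (t * τ))) := by
    refine (measureReal_iUnion_fintype_le _).trans ((Finset.sum_le_sum fun i _ =>
      measureReal_le_sum_eval_le (hF θ₀ i) (hb θ₀ i) ht (hup θ₀ i) H).trans ?_)
    simp
  have h2 : (Measure.pi fun _ : Fin H => ν).real
      (⋃ p : Θ × ι, {S : Fin H → Ω | (1 + ε) * (A + τ) < μ p.1 p.2 ∧
        ∑ l, F p.1 p.2 (S l) ≤ H * A}) ≤
      (Fintype.card Θ * Fintype.card ι) * Real.exp (-(H * (t * τ))) := by
    refine (measureReal_iUnion_fintype_le _).trans ((Finset.sum_le_sum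
      (g := fun _ => Real.exp (-(H * (t * τ)))) fun p _ => ?_).trans ?_)
    -- Badness is a deterministic condition: it supplies the margin for the lower tail, and without
    -- it the event is empty.
    · by_cases hp : (1 + ε) * (A + τ) < μ p.1 p.2
      · simp only [hp, true_and]
        refine measureReal_sum_eval_le_le (hF _ _) (hb _ _) ht ?_ (hlo _ _) H
        rw [le_div_iff₀' hε1]
        exact hp.le
      · simp only [hp, false_and, Set.ofPred_false, measureReal_empty]
        exact (Real.exp_pos _).le
    · simp
  linarith

end Sampling

/-! ### Expected loads and their exponential moments -/

instance {m n : ℕ} (D : Fin n → PMF (Fin m → ℝ)) : IsProbabilityMeasure (instanceLaw D) := by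
  unfold instanceLaw
  infer_instance

/-- The expected load of an agent under the exponentiated proportional allocation. -/
def expLoad {m n : ℕ} (D : Fin n → PMF (Fin m → ℝ)) (α : ℝ) (w : Fin m → ℝ) (i : Fin m) : ℝ :=
  ∫ P, load P (epAllocation P α w) i ∂(instanceLaw D)

theorem ae_mem_support {X : Type*} [MeasurableSpace X] [MeasurableSingletonClass X] (p : PMF X) :
    ∀ᵐ x ∂p.toMeasure, x ∈ p.support := by
  rw [← p.restrict_toMeasure_support]
  exact ae_restrict_mem p.support_countable.measurableSet

theorem ae_instanceLaw_mem_support {m n : ℕ} (D : Fin n → PMF (Fin m → ℝ)) :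
    ∀ᵐ P ∂(instanceLaw D), ∀ j, P j ∈ (D j).support :=
  ae_all_iff.2 fun j => (measurePreserving_eval (fun j => (D j).toMeasure) j
    ).quasiMeasurePreserving.ae (ae_mem_support (D j))

theorem measurable_epShare_mul {m : ℕ} (α : ℝ) (w : Fin m → ℝ) (i : Fin m) :
    Measurable fun p : Fin m → ℝ => epShare α w p i * p i := by
  unfold epShare
  fun_prop

theorem measurable_load_epAllocation {m n : ℕ} (α : ℝ) (w : Fin m → ℝ) (i : Fin m) :
    Measurable fun P : WeightMatrix m n => load P (epAllocation P α w) i := by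
  simp only [load_epAllocation]
  exact Finset.measurable_sum _ fun j _ =>
    (measurable_epShare_mul α w i).comp (measurable_pi_apply j)

section Bounded

variable {m n : ℕ} {D : Fin n → PMF (Fin m → ℝ)} {M : ℝ}

theorem epShare_mul_mem (hpos : PositiveWeights D) (hM : ∀ j, ∀ p ∈ (D j).support, ∀ i, p i ≤ M)
    {α : ℝ} {w : Fin m → ℝ} (hw : ∀ i, 0 < w i) (i : Fin m) {j : Fin n} {p : Fin m → ℝ}
    (hp : p ∈ (D j).support) : 0 ≤ epShare α w p i * p i ∧ epShare α w p i * p i ≤ M := by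
  have h0 := epShare_nonneg (α := α) (fun i => (hw i).le) (hpos j p hp) i
  have h1 := epShare_le_one (α := α) (fun i => (hw i).le) (hpos j p hp) i
  have h2 := hpos j p hp i
  refine ⟨mul_nonneg h0 h2.le, le_trans ?_ (hM j p hp i)⟩
  exact mul_le_of_le_one_left h2.le h1

theorem ae_load_mem (hpos : PositiveWeights D) (hM : ∀ j, ∀ p ∈ (D j).support, ∀ i, p i ≤ M)
    {α : ℝ} {w : Fin m → ℝ} (hw : ∀ i, 0 < w i) (i : Fin m) :
    ∀ᵐ P ∂(instanceLaw D), 0 ≤ load P (epAllocation P α w) i ∧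
      load P (epAllocation P α w) i ≤ n * M := by
  filter_upwards [ae_instanceLaw_mem_support D] with P hP
  rw [load_epAllocation]
  refine ⟨Finset.sum_nonneg fun j _ => (epShare_mul_mem hpos hM hw i (hP j)).1, ?_⟩
  refine (Finset.sum_le_sum fun j _ => (epShare_mul_mem hpos hM hw i (hP j)).2).trans ?_
  simp

theorem ae_abs_load_le (hpos : PositiveWeights D)
    (hM : ∀ j, ∀ p ∈ (D j).support, ∀ i, p i ≤ M)
    {α : ℝ} {w : Fin m → ℝ} (hw : ∀ i, 0 < w i) (i : Fin m) :
    ∀ᵐ P ∂(instanceLaw D), |load P (epAllocation P α w) i| ≤ n * M := by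
  filter_upwards [ae_load_mem (α := α) hpos hM hw i] with P hP
  rw [abs_of_nonneg hP.1]
  exact hP.2

theorem integrable_load (hpos : PositiveWeights D)
    (hM : ∀ j, ∀ p ∈ (D j).support, ∀ i, p i ≤ M)
    {α : ℝ} {w : Fin m → ℝ} (hw : ∀ i, 0 < w i) (i : Fin m) :
    Integrable (fun P => load P (epAllocation P α w) i) (instanceLaw D) :=
  Integrable.of_bound (measurable_load_epAllocation α w i).aestronglyMeasurable (n * M)
    (ae_abs_load_le hpos hM hw i)

theorem integral_exp_mul_load_le (hpos : PositiveWeights D) (hM0 : 0 < M)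
    (hM : ∀ j, ∀ p ∈ (D j).support, ∀ i, p i ≤ M)
    {α : ℝ} {w : Fin m → ℝ} (hw : ∀ i, 0 < w i) (i : Fin m) (s : ℝ) :
    ∫ P, Real.exp (s * load P (epAllocation P α w) i) ∂(instanceLaw D) ≤
      Real.exp ((Real.exp (s * M) - 1) / M * expLoad D α w i) := by
  simp only [expLoad, load_epAllocation]
  refine integral_exp_sum_eval_le hM0 (measurable_epShare_mul α w i) (fun j => ?_) s
  filter_upwards [ae_mem_support (D j)] with p hp
  exact epShare_mul_mem hpos hM hw i hp

theorem expLoad_nonneg (hpos : PositiveWeights D)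
    (hM : ∀ j, ∀ p ∈ (D j).support, ∀ i, p i ≤ M)
    {α : ℝ} {w : Fin m → ℝ} (hw : ∀ i, 0 < w i) (i : Fin m) : 0 ≤ expLoad D α w i := by
  refine integral_nonneg_of_ae ?_
  filter_upwards [ae_load_mem (α := α) hpos hM hw i] with P hP using hP.1

/-- At rate s = ε/M the chord slope is (e^ε - 1)/M, and e^ε ≤ 1 + ε + ε² for ε < 1. -/
theorem integral_exp_mul_load_le_upper (hpos : PositiveWeights D) (hM0 : 0 < M)
    (hM : ∀ j, ∀ p ∈ (D j).support, ∀ i, p i ≤ M) {ε : ℝ} (hε : 0 < ε) (hε1 : ε < 1)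
    {α : ℝ} {w : Fin m → ℝ} (hw : ∀ i, 0 < w i) (i : Fin m) :
    ∫ P, Real.exp (ε / M * load P (epAllocation P α w) i) ∂(instanceLaw D) ≤
      Real.exp (ε / M * ((1 + ε) * expLoad D α w i)) := by
  refine (integral_exp_mul_load_le hpos hM0 hM hw i _).trans (Real.exp_le_exp.2 ?_)
  have h0 := expLoad_nonneg (α := α) hpos hM hw i
  rw [div_mul_cancel₀ _ hM0.ne', ← mul_assoc]
  refine mul_le_mul_of_nonneg_right ?_ h0
  rw [div_mul_eq_mul_div]
  refine div_le_div_of_nonneg_right ?_ hM0.le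
  have := abs_le.1 (Real.abs_exp_sub_one_sub_id_le (x := ε) (by rw [abs_of_pos hε]; exact hε1.le))
  nlinarith [this.2]

/-- At rate s = -ε/M the chord slope is (e^{-ε} - 1)/M, and e^{-ε} ≤ 1/(1+ε). -/
theorem integral_exp_mul_load_le_lower (hpos : PositiveWeights D) (hM0 : 0 < M)
    (hM : ∀ j, ∀ p ∈ (D j).support, ∀ i, p i ≤ M) {ε : ℝ} (hε : 0 < ε)
    {α : ℝ} {w : Fin m → ℝ} (hw : ∀ i, 0 < w i) (i : Fin m) :
    ∫ P, Real.exp (-(ε / M) * load P (epAllocation P α w) i) ∂(instanceLaw D) ≤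
      Real.exp (-(ε / M) * (expLoad D α w i / (1 + ε))) := by
  refine (integral_exp_mul_load_le hpos hM0 hM hw i _).trans (Real.exp_le_exp.2 ?_)
  have h0 := expLoad_nonneg (α := α) hpos hM hw i
  rw [neg_mul, div_mul_cancel₀ _ hM0.ne', mul_div_assoc', mul_comm, mul_comm (-(ε / M)),
    mul_div_assoc]
  refine mul_le_mul_of_nonneg_left ?_ h0
  have h1 : Real.exp (-ε) ≤ 1 / (1 + ε) := by
    rw [Real.exp_neg, one_div]
    exact inv_anti₀ (by positivity) (by linarith [Real.add_one_le_exp ε])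
  have h2 : 1 / (1 + ε) - 1 = -ε / (1 + ε) := by field_simp; ring
  have h3 : -(ε / M) / (1 + ε) = (-ε / (1 + ε)) / M := by field_simp
  rw [h3]
  exact div_le_div_of_nonneg_right (by linarith) hM0.le

/-! ### Existence of good parameters with bounded levels -/

/-- The expected loads averaged with suitable weights are almost optimal. -/
theorem sum_mul_expLoad_le {g : ℕ} {ε : ℝ} (hm : 0 < m) (hε : 0 < ε)
    (hg : (m : ℝ) ≤ ε * (1 + ε) ^ g) (hpos : PositiveWeights D)
    (hM : ∀ j, ∀ p ∈ (D j).support, ∀ i, p i ≤ M) (hT : 0 < expOpt D)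
    {y : Fin m → ℝ} (hy : ∀ i, 0 < y i) :
    ∑ i, y i * expLoad D (-((g + 1 : ℕ) : ℝ)) (fun i => (y i)⁻¹ ^ (g + 1)) i ≤
      (1 + 2 * ε) * (∑ i, y i) * expOpt D := by
  have hw : ∀ i, 0 < (y i)⁻¹ ^ (g + 1) := fun i => pow_pos (inv_pos.2 (hy i)) _
  -- A non-integrable function has integral 0, so positivity of `expOpt D` forces integrability.
  have hopt : Integrable (fun P => optMakespan P) (instanceLaw D) := by
    by_contra h
    exact hT.ne' (integral_undef h)
  have hint := fun i => (integrable_load (α := -((g + 1 : ℕ) : ℝ)) hpos hM hw i).const_mul (y i)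
  unfold expLoad expOpt
  simp only [← integral_const_mul]
  rw [← integral_finsetSum _ fun i _ => hint i]
  refine integral_mono_ae (integrable_finsetSum _ fun i _ => hint i) (hopt.const_mul _) ?_
  filter_upwards [ae_instanceLaw_mem_support D] with P hP
  exact sum_mul_load_le hm hε hg (fun j i => hpos j _ (hP j) i) hy

theorem expLoad_le_update_of_ne (hpos : PositiveWeights D)
    (hM : ∀ j, ∀ p ∈ (D j).support, ∀ i, p i ≤ M) {α : ℝ} {w : Fin m → ℝ} (hw : ∀ i, 0 < w i)
    {i l : Fin m} (hl : l ≠ i) {a : ℝ} (ha : 0 < a) (hai : a ≤ w i) :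
    expLoad D α w l ≤ expLoad D α (Function.update w i a) l := by
  have hw' : ∀ l, 0 < Function.update w i a l := by
    intro l
    by_cases h : l = i
    · subst h; simpa using ha
    · simpa [h] using hw l
  refine integral_mono_ae (integrable_load hpos hM hw l) (integrable_load hpos hM hw' l) ?_
  filter_upwards [ae_instanceLaw_mem_support D] with P hP
  simp only [load_epAllocation]
  exact Finset.sum_le_sum fun j _ => mul_le_mul_of_nonneg_right
    (epShare_le_update_of_ne hw (hpos j _ (hP j)) hl ha hai) (hpos j _ (hP j) l).le

theorem expLoad_div_le_update (hpos : PositiveWeights D)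
    (hM : ∀ j, ∀ p ∈ (D j).support, ∀ i, p i ≤ M) {α : ℝ} {w : Fin m → ℝ} (hw : ∀ i, 0 < w i)
    (i : Fin m) {r : ℝ} (hr : 1 ≤ r) :
    expLoad D α w i / r ≤ expLoad D α (Function.update w i (w i / r)) i := by
  have hw' : ∀ l, 0 < Function.update w i (w i / r) l := by
    intro l
    by_cases h : l = i
    · subst h; simpa using div_pos (hw l) (by linarith)
    · simpa [h] using hw l
  unfold expLoad
  rw [← integral_div]
  refine integral_mono_ae ((integrable_load hpos hM hw i).div_const r)
    (integrable_load hpos hM hw' i) ?_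
  filter_upwards [ae_instanceLaw_mem_support D] with P hP
  simp only [load_epAllocation]
  rw [Finset.sum_div]
  refine Finset.sum_le_sum fun j _ => ?_
  rw [mul_div_right_comm]
  exact mul_le_mul_of_nonneg_right
    (epShare_div_le_update hw (hpos j _ (hP j)) i hr) (hpos j _ (hP j) i).le

/-- If all agents below the top level have large expected load, then no level is far below the
top level. -/
theorem lt_of_forall_le_expLoad {g bot top : ℕ} {ε B : ℝ} (hm : 0 < m) (hε : 0 < ε)
    (hg : (m : ℝ) ≤ ε * (1 + ε) ^ g) (htop : bot + m * ((g + 1) * g) < top)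
    (hpos : PositiveWeights D) (hM : ∀ j, ∀ p ∈ (D j).support, ∀ i, p i ≤ M)
    (hT : 0 < expOpt D) (hB : (1 + 2 * ε) * (1 + ε) * expOpt D < B) {t : Fin m → ℕ}
    (ht : ∀ i, t i < top → B ≤ expLoad D (-((g + 1 : ℕ) : ℝ)) (fun i => (1 + ε) ^ t i) i)
    (a : Fin m) : bot < t a := by
  by_contra! ha
  obtain ⟨s, hs, hgap⟩ := exists_gap (G := (g + 1) * g) (f := fun i => top - t i) (a := a)
    (by omega)
  have hε1 : (0 : ℝ) < 1 + ε := by linarith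
  -- With this root, y i = η^{-t i} reproduces w i = (1+ε)^{t i}, and a gap of (g+1)g levels changes
  -- y by at least the factor (1+ε)^g ≥ m/ε.
  set η : ℝ := (1 + ε) ^ (((g + 1 : ℕ) : ℝ)⁻¹) with hη
  have hη0 : 0 < η := Real.rpow_pos_of_pos hε1 _
  have hη1 : 1 ≤ η := Real.one_le_rpow (by linarith) (by positivity)
  have hηp : η ^ (g + 1) = 1 + ε := Real.rpow_inv_natCast_pow hε1.le (by omega)
  set y : Fin m → ℝ := fun i => (η ^ t i)⁻¹ with hy
  have hy0 : ∀ i, 0 < y i := fun i => by positivity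
  have hyw : (fun i => (y i)⁻¹ ^ (g + 1)) = fun i => (1 + ε) ^ t i := by
    funext i
    rw [hy]
    simp only [inv_inv]
    rw [← pow_mul, mul_comm, pow_mul, hηp]
  have hmain := sum_mul_expLoad_le hm hε hg hpos hM hT hy0
  rw [hyw] at hmain
  set L := fun i => expLoad D (-((g + 1 : ℕ) : ℝ)) (fun i => (1 + ε) ^ t i) i with hL
  have hL0 : ∀ i, 0 ≤ L i := fun i => expLoad_nonneg hpos hM (fun i => by positivity) i
  -- S collects the agents beneath the empty window. All of them are below the top, hence have load
  -- at least B; the others together weigh at most ε * y a.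
  set S := Finset.univ.filter fun i => s + (g + 1) * g < top - t i with hS
  have haS : a ∈ S := by simpa [hS] using hs
  have h1 : ∑ i ∈ S, y i * B ≤ ∑ i, y i * L i := by
    refine (Finset.sum_le_sum fun i hi => ?_).trans
      (Finset.sum_le_sum_of_subset_of_nonneg (Finset.subset_univ S)
        fun i _ _ => mul_nonneg (hy0 i).le (hL0 i))
    have hi' : s + (g + 1) * g < top - t i := by simpa [hS] using hi
    exact mul_le_mul_of_nonneg_left (ht i (by omega)) (hy0 i).le
  have h2 : ∀ i, i ∉ S → y i ≤ ε / m * y a := by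
    intro i hi
    have hi' : ¬ s + (g + 1) * g < top - t i := by simpa [hS] using hi
    have hi2 : top - t i ≤ s := (hgap i).resolve_right hi'
    have hi3 : t a + (g + 1) * g ≤ t i := by
      have : s + (g + 1) * g < top - t a := hs
      omega
    have hm' : (0 : ℝ) < m := by exact_mod_cast hm
    have h3 : m * (η ^ t a) ≤ ε * η ^ t i := by
      calc m * η ^ t a ≤ ε * (1 + ε) ^ g * η ^ t a :=
            mul_le_mul_of_nonneg_right hg (by positivity)
        _ = ε * η ^ (t a + (g + 1) * g) := by rw [pow_add, pow_mul, hηp]; ring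
        _ ≤ ε * η ^ t i := mul_le_mul_of_nonneg_left (pow_le_pow_right₀ hη1 hi3) hε.le
    simp only [hy]
    rw [← div_eq_mul_inv, div_div, inv_eq_one_div, div_le_div_iff₀ (by positivity) (by positivity)]
    linarith
  have h3 : ∑ i ∈ Sᶜ, y i ≤ ε * y a := by
    refine (Finset.sum_le_sum fun i hi => h2 i (Finset.mem_compl.1 hi)).trans ?_
    rw [Finset.sum_const, nsmul_eq_mul]
    have hm' : (0 : ℝ) < m := by exact_mod_cast hm
    have hc : ((Sᶜ).card : ℝ) ≤ m := by
      have := Finset.card_le_univ (Sᶜ)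
      rw [Fintype.card_fin] at this
      exact_mod_cast this
    calc ((Sᶜ).card : ℝ) * (ε / m * y a) ≤ m * (ε / m * y a) :=
          mul_le_mul_of_nonneg_right hc (mul_nonneg (by positivity) (hy0 a).le)
      _ = ε * y a := by field_simp
  have h4 : y a ≤ ∑ i ∈ S, y i := Finset.single_le_sum (fun i _ => (hy0 i).le) haS
  have h5 : ∑ i, y i = ∑ i ∈ S, y i + ∑ i ∈ Sᶜ, y i := (Finset.sum_add_sum_compl S y).symm
  rw [← Finset.sum_mul] at h1
  have h6 : ∑ i, y i ≤ (1 + ε) * ∑ i ∈ S, y i := by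
    have := mul_le_mul_of_nonneg_left h4 hε.le
    linarith
  have h7 : 0 < ∑ i ∈ S, y i := (hy0 a).trans_le h4
  have h8 : (1 + 2 * ε) * (∑ i, y i) * expOpt D ≤
      (1 + 2 * ε) * ((1 + ε) * ∑ i ∈ S, y i) * expOpt D := by gcongr
  have h9 := mul_lt_mul_of_pos_left hB h7
  linarith

/-- Some parameters that are powers of `1 + ε` from a bounded range make all expected loads almost
optimal. -/
theorem exists_levels {g bot top : ℕ} {ε : ℝ} (hm : 0 < m) (hε : 0 < ε)
    (hg : (m : ℝ) ≤ ε * (1 + ε) ^ g) (htop : bot + m * ((g + 1) * g) < top)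
    (hpos : PositiveWeights D) (hM : ∀ j, ∀ p ∈ (D j).support, ∀ i, p i ≤ M)
    (hT : 0 < expOpt D) :
    ∃ t : Fin m → ℕ, (∀ i, t i ∈ Finset.Icc bot top) ∧ ∀ i,
      expLoad D (-((g + 1 : ℕ) : ℝ)) (fun i => (1 + ε) ^ t i) i ≤
        (1 + 2 * ε) * (1 + ε) ^ 3 * expOpt D := by
  classical
  have hε1 : (0 : ℝ) < 1 + ε := by linarith
  -- The second factor 1+ε gives the strict inequality in `hBlt`. A third appears in the conclusion,
  -- since a load above (1+ε)B stays at least B after one lowering.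
  set B := (1 + 2 * ε) * (1 + ε) ^ 2 * expOpt D with hB
  set L : (Fin m → ℕ) → Fin m → ℝ := fun t i =>
    expLoad D (-((g + 1 : ℕ) : ℝ)) (fun i => (1 + ε) ^ t i) i with hL
  have hBlt : (1 + 2 * ε) * (1 + ε) * expOpt D < B := by
    rw [hB]
    have : 0 < (1 + 2 * ε) * (1 + ε) * expOpt D := by positivity
    nlinarith
  -- F is the invariant of the descent. An element of minimal level sum is an endpoint: an
  -- overloaded agent could still be lowered inside F.
  set F := (Fintype.piFinset fun _ : Fin m => Finset.Icc bot top).filter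
    fun t => ∀ i, t i < top → B ≤ L t i with hF
  have hne : F.Nonempty := by
    refine ⟨fun _ => top, ?_⟩
    simp only [hF, Finset.mem_filter, Fintype.mem_piFinset, Finset.mem_Icc]
    exact ⟨fun _ => ⟨by omega, le_rfl⟩, fun i h => absurd h (lt_irrefl _)⟩
  obtain ⟨t, htF, hmin⟩ := F.exists_min_image (fun t => ∑ i, t i) hne
  simp only [hF, Finset.mem_filter, Fintype.mem_piFinset] at htF
  refine ⟨t, htF.1, fun i => ?_⟩
  by_contra! hi
  have hbot : bot < t i := lt_of_forall_le_expLoad hm hε hg htop hpos hM hT hBlt htF.2 i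
  have hw : ∀ l, 0 < (fun l => (1 + ε) ^ t l) l := fun l => by positivity
  have hupd : (fun l => (1 + ε) ^ Function.update t i (t i - 1) l) =
      Function.update (fun l => (1 + ε) ^ t l) i ((1 + ε) ^ t i / (1 + ε)) := by
    funext l
    by_cases h : l = i
    · subst h
      obtain ⟨r, hr⟩ := Nat.exists_eq_succ_of_ne_zero (show t l ≠ 0 by omega)
      simp only [Function.update_self, hr, Nat.succ_eq_add_one, Nat.add_sub_cancel, pow_succ]
      rw [mul_div_cancel_right₀ _ hε1.ne']
    · simp [h]
  have hmem : Function.update t i (t i - 1) ∈ F := by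
    simp only [hF, Finset.mem_filter, Fintype.mem_piFinset]
    constructor
    · intro l
      by_cases h : l = i
      · subst h
        have := Finset.mem_Icc.1 (htF.1 l)
        rw [Function.update_self, Finset.mem_Icc]
        omega
      · rw [Function.update_of_ne h]
        exact htF.1 l
    · intro l hl
      simp only [hL]
      rw [hupd]
      by_cases h : l = i
      · subst h
        refine le_trans ?_ (expLoad_div_le_update hpos hM hw l (by linarith))
        rw [le_div_iff₀ hε1]
        refine le_trans (le_of_eq ?_) hi.le
        rw [hB]; ring
      · rw [Function.update_of_ne h] at hl
        refine (htF.2 l hl).trans (expLoad_le_update_of_ne hpos hM hw h (by positivity) ?_)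
        exact div_le_self (hw i).le (by linarith)
  have hsum := hmin _ hmem
  have h1 := Finset.add_sum_erase Finset.univ t (Finset.mem_univ i)
  have h2 := Finset.add_sum_erase Finset.univ (Function.update t i (t i - 1)) (Finset.mem_univ i)
  have h3 : ∑ l ∈ Finset.univ.erase i, Function.update t i (t i - 1) l =
      ∑ l ∈ Finset.univ.erase i, t l :=
    Finset.sum_congr rfl fun l hl => Function.update_of_ne (Finset.ne_of_mem_erase hl) _ _
  rw [h3, Function.update_self] at h2
  omega

end Bounded

/-! ### Points of the net -/

/-- The element of the net with exponents `θ.1 i + 1` and `θ.2 i + 1`. -/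
def netPoint {m K : ℕ} (ε α : ℝ) (θ : (Fin m → Fin K) × (Fin m → Fin K)) (i : Fin m) : ℝ :=
  (1 + ε) ^ ((θ.2 i : ℕ) + 1) / ((1 + ε) ^ ((θ.1 i : ℕ) + 1)) ^ α

theorem netPoint_mem_net {m K : ℕ} (ε α : ℝ) (θ : (Fin m → Fin K) × (Fin m → Fin K)) :
    netPoint ε α θ ∈ net m ε α K := by
  refine ⟨fun i => (1 + ε) ^ ((θ.1 i : ℕ) + 1), fun i => (1 + ε) ^ ((θ.2 i : ℕ) + 1),
    fun i => ⟨_, ?_, rfl⟩, fun i => ⟨_, ?_, rfl⟩, fun i => rfl⟩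
  · have := (θ.1 i).2
    rw [Finset.mem_Icc]
    omega
  · have := (θ.2 i).2
    rw [Finset.mem_Icc]
    omega

theorem netPoint_pos {m K : ℕ} {ε : ℝ} (hε : 0 < ε) (α : ℝ)
    (θ : (Fin m → Fin K) × (Fin m → Fin K)) (i : Fin m) : 0 < netPoint ε α θ i := by
  unfold netPoint
  positivity

/-- The net for `α = -k` with `k ≤ K` contains all vectors of powers of `1 + ε` with exponents
from `k + 1` to `K * k + k`. -/
theorem exists_netPoint_eq {m K k : ℕ} {ε : ℝ} (hε : 0 < ε) (hk : 0 < k) (hkK : k ≤ K)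
    {t : Fin m → ℕ} (ht : ∀ i, t i ∈ Finset.Icc (k + 1) (K * k + k)) :
    ∃ θ : (Fin m → Fin K) × (Fin m → Fin K),
      netPoint ε (-(k : ℝ)) θ = fun i => (1 + ε) ^ t i := by
  have h1 : ∀ i, 1 ≤ (t i - 1) / k := fun i => by
    have := Finset.mem_Icc.1 (ht i)
    rw [Nat.le_div_iff_mul_le hk]
    omega
  have h2 : ∀ i, (t i - 1) / k - 1 < K := fun i => by
    have := Finset.mem_Icc.1 (ht i)
    have h3 : (t i - 1) / k < K + 1 := by
      rw [Nat.div_lt_iff_lt_mul hk, add_mul]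
      omega
    have := h1 i
    omega
  -- Division of t i - 1 by k: the quotient is the exponent of u, the remainder plus one that of δ.
  -- The shift is there because both exponents start at 1.
  refine ⟨(fun i => ⟨(t i - 1) / k - 1, h2 i⟩,
    fun i => ⟨(t i - 1) % k, (Nat.mod_lt _ hk).trans_le hkK⟩), ?_⟩
  funext i
  have hε1 : 0 < 1 + ε := by linarith
  simp only [netPoint]
  rw [Nat.sub_add_cancel (h1 i), Real.rpow_neg (by positivity), Real.rpow_natCast, div_inv_eq_mul,
    ← pow_mul, ← pow_add]
  congr 1
  have := Nat.div_add_mod' (t i - 1) k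
  have := Finset.mem_Icc.1 (ht i)
  omega

/-! ### Expected makespan and the guarantee for the minimizer -/

instance {m n H : ℕ} (D : Fin n → PMF (Fin m → ℝ)) : IsProbabilityMeasure (sampleLaw D H) := by
  unfold sampleLaw
  infer_instance

theorem expOpt_pos {m n : ℕ} (hm : 0 < m) (hn : 0 < n) {D : Fin n → PMF (Fin m → ℝ)} {ζ : ℝ}
    (hζ : 0 < ζ) (hpos : PositiveWeights D) (hsmall : SmallItems D ζ) : 0 < expOpt D := by
  obtain ⟨p, hp⟩ := (D ⟨0, hn⟩).support_nonempty
  have := (hpos _ p hp ⟨0, hm⟩).trans_le (hsmall _ p hp ⟨0, hm⟩)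
  by_contra! h
  linarith [div_nonpos_of_nonpos_of_nonneg h hζ.le]

theorem expOpt_nonneg {m n : ℕ} (hm : 0 < m) {D : Fin n → PMF (Fin m → ℝ)}
    (hpos : PositiveWeights D) : 0 ≤ expOpt D := by
  refine integral_nonneg_of_ae ?_
  filter_upwards [ae_instanceLaw_mem_support D] with P hP
  exact optMakespan_nonneg hm fun j i => hpos j _ (hP j) i

theorem expMakespan_eq_zero {m n : ℕ} (hn : n = 0) (D : Fin n → PMF (Fin m → ℝ)) (α : ℝ)
    (w : Fin m → ℝ) : expMakespan D α w = 0 := by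
  subst hn
  simp [expMakespan, makespan, load]

/-- If all expected loads are at most `B`, the expected makespan is not much larger. -/
theorem expMakespan_le {m n : ℕ} (hm : 0 < m) {D : Fin n → PMF (Fin m → ℝ)} {M ε B : ℝ}
    (hpos : PositiveWeights D) (hM0 : 0 < M)
    (hM : ∀ j, ∀ p ∈ (D j).support, ∀ i, p i ≤ M) (hε : 0 < ε) (hε1 : ε < 1)
    {α : ℝ} {w : Fin m → ℝ} (hw : ∀ i, 0 < w i) (hB : ∀ i, expLoad D α w i ≤ B) :
    expMakespan D α w ≤ Real.log m / (ε / M) + (1 + ε) * B := by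
  refine integral_iSup_le (F := fun i P => load P (epAllocation P α w) i) hm (div_pos hε hM0)
    ?_ (fun i => ?_) fun i => ?_
  · refine ae_all_iff.2 fun i => ?_
    filter_upwards [ae_load_mem (α := α) hpos hM hw i] with P hP using hP.1
  · exact integrable_exp_mul_of_bound (measurable_load_epAllocation α w i)
      (ae_abs_load_le hpos hM hw i) _
  · refine (integral_exp_mul_load_le_upper hpos hM0 hM hε hε1 hw i).trans (Real.exp_le_exp.2 ?_)
    have := hB i
    gcongr

/-- From the outside in, the single factors 1+ε come from the expected maximum, the lower tail and
the upper tail; (1+2ε)(1+ε)³ comes from `exists_levels`, and ε + ε from the two deviations τ. -/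
theorem error_polynomial_le {ε : ℝ} (hε : 0 < ε) (hε1 : ε < 1) :
    (1 + ε) * ((1 + ε) * ((1 + ε) * ((1 + 2 * ε) * (1 + ε) ^ 3) + ε + ε)) ≤ 1 + 200 * ε := by
  have key : ∀ a b : ℝ, 0 ≤ a → 0 ≤ b → (1 + a * ε) * (1 + b * ε) ≤ 1 + (a + b + a * b) * ε := by
    intro a b ha hb
    have : a * b * (ε * ε) ≤ a * b * ε :=
      mul_le_mul_of_nonneg_left (by nlinarith) (mul_nonneg ha hb)
    nlinarith
  have h2 := key 1 1 (by norm_num) (by norm_num)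
  have h3 := key 3 1 (by norm_num) (by norm_num)
  have h6 := key 7 7 (by norm_num) (by norm_num)
  have h7 := key 63 2 (by norm_num) (by norm_num)
  norm_num at h2 h3 h6 h7
  have e2 : (1 + ε) ^ 2 ≤ 1 + 3 * ε := by nlinarith
  have e3 : (1 + ε) ^ 3 ≤ 1 + 7 * ε := by nlinarith
  have e6 : (1 + ε) ^ 6 ≤ 1 + 63 * ε := by
    have : (1 + ε) ^ 6 = (1 + ε) ^ 3 * (1 + ε) ^ 3 := by ring
    rw [this]
    exact (mul_le_mul e3 e3 (by positivity) (by positivity)).trans h6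
  have e7 : (1 + ε) ^ 6 * (1 + 2 * ε) ≤ 1 + 191 * ε :=
    (mul_le_mul_of_nonneg_right e6 (by positivity)).trans h7
  have e8 : (1 + ε) ^ 2 * (2 * ε) ≤ 4 * (2 * ε) :=
    mul_le_mul_of_nonneg_right (by nlinarith) (by positivity)
  nlinarith

/-- A minimizer of the maximal empirical load over the net has almost optimal expected makespan
with high probability. -/
theorem sampleLaw_minimizer_le {m n H g K : ℕ} {ε c : ℝ} (hm : 2 ≤ m) (hε : 0 < ε) (hε1 : ε < 1)
    (hc : 0 < c) (hg : (m : ℝ) ≤ ε * (1 + ε) ^ g) (hK : m * g + 2 ≤ K)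
    {est : (Fin H → WeightMatrix m n) → (Fin m → Fin K) × (Fin m → Fin K)}
    (hest : ∀ S (θ : (Fin m → Fin K) × (Fin m → Fin K)) i, ∃ j,
      ∑ l, load (S l) (epAllocation (S l) (-((g + 1 : ℕ) : ℝ))
        (netPoint ε (-((g + 1 : ℕ) : ℝ)) (est S))) i ≤
      ∑ l, load (S l) (epAllocation (S l) (-((g + 1 : ℕ) : ℝ))
        (netPoint ε (-((g + 1 : ℕ) : ℝ)) θ)) j)
    {D : Fin n → PMF (Fin m → ℝ)} (hpos : PositiveWeights D)
    (hsmall : SmallItems D (c * (Real.log m / ε ^ 2))) (hT : 0 < expOpt D) :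
    (sampleLaw D H).real {S | ¬ expMakespan D (-((g + 1 : ℕ) : ℝ))
        (netPoint ε (-((g + 1 : ℕ) : ℝ)) (est S)) ≤ (1 + (200 + 1 / c) * ε) * expOpt D} ≤
      (m * (1 + K ^ m * K ^ m)) * Real.exp (-(H * (c * Real.log m))) := by
  have hm0 : 0 < m := by omega
  have hlog : 0 < Real.log m := Real.log_pos (by exact_mod_cast hm)
  have hζ : 0 < c * (Real.log m / ε ^ 2) := by positivity
  have hg0 : g ≠ 0 := by
    rintro rfl
    have : (2 : ℝ) ≤ m := by exact_mod_cast hm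
    rw [pow_zero] at hg
    linarith
  have hmg : g ≤ m * g := Nat.le_mul_of_pos_left _ hm0
  set M := expOpt D / (c * (Real.log m / ε ^ 2)) with hMdef
  have hM0 : 0 < M := div_pos hT hζ
  have hM : ∀ j, ∀ p ∈ (D j).support, ∀ i, p i ≤ M := hsmall
  -- The two ends are the extreme exponents that `exists_netPoint_eq` offers for k = g + 1.
  have htop : (g + 1) + 1 + m * ((g + 1) * g) < K * (g + 1) + (g + 1) := by
    have : (m * g + 2) * (g + 1) ≤ K * (g + 1) := Nat.mul_le_mul_right _ hK
    nlinarith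
  obtain ⟨t, ht, htB⟩ := exists_levels hm0 hε hg htop hpos hM hT
  obtain ⟨θ₀, hθ₀⟩ := exists_netPoint_eq hε (Nat.succ_pos g) (by omega) ht
  rw [← hθ₀] at htB
  have hw := fun θ : (Fin m → Fin K) × (Fin m → Fin K) =>
    netPoint_pos hε (-((g + 1 : ℕ) : ℝ)) θ
  have main := measureReal_minimizer_le (ν := instanceLaw D) (H := H) (τ := ε * expOpt D)
    (F := fun θ i P => load P (epAllocation P (-((g + 1 : ℕ) : ℝ))
      (netPoint ε (-((g + 1 : ℕ) : ℝ)) θ)) i) hε (div_pos hε hM0)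
    (fun θ i => measurable_load_epAllocation _ _ i)
    (fun θ i => ae_abs_load_le hpos hM (hw θ) i)
    (fun θ i => integral_exp_mul_load_le_upper hpos hM0 hM hε hε1 (hw θ) i)
    (fun θ i => integral_exp_mul_load_le_lower hpos hM0 hM hε (hw θ) i) htB hest
  -- With deviation τ = εT the exponent per sample is ε²ζ, so the small items assumption makes it
  -- c·log m.
  have hexp : ε / M * (ε * expOpt D) = c * Real.log m := by
    rw [hMdef]
    field_simp
  rw [hexp] at main
  simp only [Fintype.card_fin, Fintype.card_prod, Fintype.card_fun, Nat.cast_mul,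
    Nat.cast_pow] at main
  refine le_trans (measureReal_mono ?_) main
  intro S hS
  by_contra hcon
  refine hS ?_
  have hB : ∀ i, expLoad D (-((g + 1 : ℕ) : ℝ)) (netPoint ε (-((g + 1 : ℕ) : ℝ)) (est S)) i ≤
      (1 + ε) * ((1 + ε) * ((1 + 2 * ε) * (1 + ε) ^ 3 * expOpt D) + ε * expOpt D +
        ε * expOpt D) := by
    intro i
    by_contra! h
    exact hcon ⟨i, h⟩
  refine (expMakespan_le hm0 hpos hM0 hM hε hε1 (hw _) hB).trans ?_
  -- The cost of exchanging maximum and expectation is the source of 1/c in the error constant.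
  have e1 : Real.log m / (ε / M) = 1 / c * ε * expOpt D := by
    rw [hMdef]
    field_simp
  have e2 := mul_le_mul_of_nonneg_right (error_polynomial_le hε hε1) hT.le
  rw [e1]
  nlinarith

/-- The est S minimizes the maximum over ι; the existential j compares maxima in the form that
`measureReal_minimizer_le` consumes. -/
theorem exists_minimizer {A Θ ι : Type*} [Finite Θ] [Nonempty Θ] [Fintype ι] [Nonempty ι]
    (F : A → Θ → ι → ℝ) : ∃ est : A → Θ, ∀ S θ i, ∃ j, F S (est S) i ≤ F S θ j := by
  have h : ∀ S, ∃ θ₀, ∀ θ i, ∃ j, F S θ₀ i ≤ F S θ j := by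
    intro S
    obtain ⟨θ₀, h⟩ := Finite.exists_min fun θ => Finset.univ.sup' Finset.univ_nonempty (F S θ)
    refine ⟨θ₀, fun θ i => ?_⟩
    obtain ⟨j, -, hj⟩ := Finset.exists_mem_eq_sup' Finset.univ_nonempty (F S θ)
    refine ⟨j, ?_⟩
    rw [← hj]
    exact (Finset.le_sup' (F S θ₀) (Finset.mem_univ i)).trans (h θ)
  choose est hest using h
  exact ⟨est, hest⟩

/-! ### Numerical choice of g, K and H -/

section Parameters

variable {m : ℕ} {ε : ℝ}

theorem two_le_div (hm : 2 ≤ m) (hε : 0 < ε) (hε1 : ε < 1) : (m : ℝ) ≤ m / ε ∧ 2 ≤ m / ε := by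
  have hm' : (2 : ℝ) ≤ m := by exact_mod_cast hm
  have : (m : ℝ) ≤ m / ε := by
    rw [le_div_iff₀ hε]
    nlinarith
  exact ⟨this, hm'.trans this⟩

theorem half_le_log {x : ℝ} (hx : 2 ≤ x) : 1 / 2 ≤ Real.log x := by
  have := Real.log_le_log (by norm_num) hx
  linarith [Real.log_two_gt_d9]

theorem le_mul_one_add_pow (hm : 2 ≤ m) (hε : 0 < ε) (hε1 : ε < 1) :
    (m : ℝ) ≤ ε * (1 + ε) ^ ⌈2 * Real.log (m / ε) / ε⌉₊ := by
  obtain ⟨-, h2⟩ := two_le_div hm hε hε1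
  have hl := half_le_log h2
  have h1 : ε / 2 ≤ Real.log (1 + ε) := by
    refine le_trans ?_ (Real.le_log_one_add_of_nonneg hε.le)
    rw [div_le_div_iff₀ (by norm_num) (by positivity)]
    nlinarith
  rw [← div_le_iff₀' hε, ← Real.log_le_log_iff (by linarith) (by positivity), Real.log_pow]
  calc Real.log (m / ε) = 2 * Real.log (m / ε) / ε * (ε / 2) := by field_simp
    _ ≤ ⌈2 * Real.log (m / ε) / ε⌉₊ * Real.log (1 + ε) :=
      mul_le_mul (Nat.le_ceil _) h1 (by positivity) (Nat.cast_nonneg _)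

/-- Write x = m/ε. The ceiling costs 2·x·log x + m, and m + 2 ≤ 2x ≤ 4·x·log x because log x ≥ 1/2;
hence the 6. -/
theorem mul_ceil_add_two_le_floor (hm : 2 ≤ m) (hε : 0 < ε) (hε1 : ε < 1) :
    m * ⌈2 * Real.log (m / ε) / ε⌉₊ + 2 ≤ ⌊6 * (m / ε * Real.log (m / ε))⌋₊ := by
  obtain ⟨h1, h2⟩ := two_le_div hm hε hε1
  have hl := half_le_log h2
  have hm' : (2 : ℝ) ≤ m := by exact_mod_cast hm
  refine Nat.le_floor ?_
  push_cast
  have h3 : (⌈2 * Real.log (m / ε) / ε⌉₊ : ℝ) ≤ 2 * Real.log (m / ε) / ε + 1 :=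
    (Nat.ceil_lt_add_one (by positivity)).le
  have h4 := mul_le_mul_of_nonneg_left h3 (by linarith : (0 : ℝ) ≤ m)
  have h5 : (m : ℝ) * (2 * Real.log (m / ε) / ε + 1) = 2 * (m / ε * Real.log (m / ε)) + m := by
    ring
  have h6 : (m : ℝ) / ε * (1 / 2) ≤ m / ε * Real.log (m / ε) :=
    mul_le_mul_of_nonneg_left hl (by positivity)
  linarith

theorem floor_le_pow (hm : 2 ≤ m) (hε : 0 < ε) (hε1 : ε < 1) :
    (⌊6 * (m / ε * Real.log (m / ε))⌋₊ : ℝ) ≤ (m / ε) ^ 5 := by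
  obtain ⟨-, h2⟩ := two_le_div hm hε hε1
  have hl := half_le_log h2
  set x : ℝ := m / ε
  have h3 : Real.log x ≤ x := (Real.log_le_sub_one_of_pos (by linarith)).trans (by linarith)
  have h4 : (2 : ℝ) ^ 3 ≤ x ^ 3 := pow_le_pow_left₀ (by norm_num) h2 3
  calc (⌊6 * (x * Real.log x)⌋₊ : ℝ) ≤ 6 * (x * Real.log x) := Nat.floor_le (by positivity)
    _ ≤ 6 * (x * x) := by gcongr
    _ ≤ x ^ 3 * (x * x) := by gcongr; linarith
    _ = x ^ 5 := by ring

/-- This lets the +2 in the sample constant absorb the rounding up of H. -/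
theorem half_le_samples (hm : 2 ≤ m) (hε : 0 < ε) (hε1 : ε < 1) :
    1 / 2 ≤ (m : ℝ) / Real.log m * Real.log (m / ε) := by
  obtain ⟨-, h2⟩ := two_le_div hm hε hε1
  have hl := half_le_log h2
  have hm' : (2 : ℝ) ≤ m := by exact_mod_cast hm
  have hlm := half_le_log hm'
  have h1 : 1 ≤ (m : ℝ) / Real.log m := by
    rw [le_div_iff₀ (by linarith), one_mul]
    exact (Real.log_le_sub_one_of_pos (by linarith)).trans (by linarith)
  nlinarith

/-- With enough samples, the union bound over the net and the agents succeeds. -/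
theorem union_bound_le {c : ℝ} {b H K : ℕ} (hm : 2 ≤ m) (hε : 0 < ε) (hε1 : ε < 1) (hc : 0 < c)
    (hK : (K : ℝ) ≤ (m / ε) ^ 5)
    (hH : (b + 12) / c * (m / Real.log m * Real.log (m / ε)) ≤ H) :
    (m * (1 + (K : ℝ) ^ m * (K : ℝ) ^ m)) * Real.exp (-(H * (c * Real.log m))) ≤
      (ε / m) ^ (b * m) := by
  obtain ⟨h1, h2⟩ := two_le_div hm hε hε1
  have hm' : (2 : ℝ) ≤ m := by exact_mod_cast hm
  have hlm := half_le_log hm'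
  have hinv : ε / m = ((m : ℝ) / ε)⁻¹ := (inv_div _ _).symm
  rw [hinv]
  set x : ℝ := m / ε with hx
  have hx0 : 0 < x := by linarith
  have hx1 : 1 ≤ x := by linarith
  have e1 : Real.exp (-(H * (c * Real.log m))) ≤ (x ^ ((b + 12) * m))⁻¹ := by
    rw [Real.exp_neg]
    refine inv_anti₀ (by positivity) ?_
    rw [← Real.exp_log (show 0 < x ^ ((b + 12) * m) by positivity), Real.exp_le_exp, Real.log_pow]
    have := mul_le_mul_of_nonneg_right hH (mul_pos hc (by linarith : 0 < Real.log m)).le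
    refine le_trans (le_of_eq ?_) this
    push_cast
    field_simp
  have e2 : (K : ℝ) ^ m * (K : ℝ) ^ m ≤ x ^ (10 * m) := by
    calc (K : ℝ) ^ m * (K : ℝ) ^ m ≤ (x ^ 5) ^ m * (x ^ 5) ^ m := by gcongr
      _ = x ^ (10 * m) := by rw [← pow_mul, ← pow_add]; congr 1; ring
  have e3 : 1 ≤ x ^ (10 * m) := one_le_pow₀ hx1
  -- The net costs x^{10m}, the prefactor m and the summand 1 cost x each, and 10m + 2 ≤ 12m. This
  -- is the 12 in the number of samples.
  have e4 : m * (1 + (K : ℝ) ^ m * (K : ℝ) ^ m) ≤ x ^ (12 * m) := by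
    calc m * (1 + (K : ℝ) ^ m * (K : ℝ) ^ m) ≤ x * (x * x ^ (10 * m)) := by
          refine mul_le_mul h1 ?_ (by positivity) hx0.le
          nlinarith
      _ = x ^ (10 * m + 2) := by ring
      _ ≤ x ^ (12 * m) := pow_le_pow_right₀ hx1 (by omega)
  calc _ ≤ x ^ (12 * m) * (x ^ ((b + 12) * m))⁻¹ := by gcongr
    _ = x⁻¹ ^ (b * m) := by
      rw [add_mul, pow_add, inv_pow]
      field_simp

end Parameters

end OnlineAllocation
end

/-! ### Assembly -/

theorem theorem6p2 :
    ∃ (α : ℕ → ℝ → ℝ) (C_net : ℝ),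
      (∀ m ε, α m ε < 0) ∧ 0 < C_net ∧
      ∀ c : ℝ, 0 < c → ∃ C_err : ℝ, 0 < C_err ∧
      ∀ b : ℕ, ∃ C_smp : ℝ, 0 < C_smp ∧
      ∀ (m : ℕ) (ε : ℝ), 2 ≤ m → 0 < ε → ε < 1 →
      ∃ H : ℕ, (H : ℝ) ≤ C_smp * ((m / Real.log m) * Real.log (m / ε)) ∧
      ∀ n : ℕ,
      ∃ learner : (Fin H → OnlineAllocation.WeightMatrix m n) → (Fin m → ℝ),
        (∀ S, learner S ∈
          OnlineAllocation.net m ε (α m ε) ⌊C_net * ((m / ε) * Real.log (m / ε))⌋₊) ∧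
        ∀ D : Fin n → PMF (Fin m → ℝ),
          OnlineAllocation.PositiveWeights D →
          OnlineAllocation.SmallItems D (c * (Real.log m / ε ^ 2)) →
          OnlineAllocation.sampleLaw D H
            {S | ¬ OnlineAllocation.expMakespan D (α m ε) (learner S) ≤
                (1 + C_err * ε) * OnlineAllocation.expOpt D}
            ≤ ENNReal.ofReal ((ε / m) ^ (b * m)) := by
  refine ⟨fun m ε => -((⌈2 * Real.log (m / ε) / ε⌉₊ + 1 : ℕ) : ℝ), 6, fun m ε => ?_, by norm_num,
    fun c hc => ⟨200 + 1 / c, by positivity, fun b => ⟨(b + 12) / c + 2, by positivity,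
    fun m ε hm hε hε1 => ⟨⌈(b + 12) / c * (m / Real.log m * Real.log (m / ε))⌉₊, ?_,
    fun n => ?_⟩⟩⟩⟩
  · rw [neg_lt_zero]
    positivity
  · have hY := OnlineAllocation.half_le_samples hm hε hε1
    have := Nat.ceil_lt_add_one
      (show 0 ≤ (b + 12) / c * (m / Real.log m * Real.log (m / ε)) by positivity)
    linarith
  beta_reduce
  have hK := OnlineAllocation.mul_ceil_add_two_le_floor hm hε hε1
  generalize hKdef : ⌊6 * (m / ε * Real.log (m / ε))⌋₊ = K at hK ⊢
  have hg := OnlineAllocation.le_mul_one_add_pow hm hε hε1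
  generalize ⌈2 * Real.log (m / ε) / ε⌉₊ = g at hK hg ⊢
  have hH := Nat.le_ceil ((b + 12) / c * (m / Real.log m * Real.log (m / ε)))
  generalize ⌈(b + 12) / c * (m / Real.log m * Real.log (m / ε))⌉₊ = H at hH ⊢
  have : Nonempty (Fin K) := ⟨⟨0, by omega⟩⟩
  have : Nonempty (Fin m) := ⟨⟨0, by omega⟩⟩
  obtain ⟨est, hest⟩ := OnlineAllocation.exists_minimizer
    fun (S : Fin H → OnlineAllocation.WeightMatrix m n)
      (θ : (Fin m → Fin K) × (Fin m → Fin K)) i =>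
      ∑ l, OnlineAllocation.load (S l) (OnlineAllocation.epAllocation (S l) (-((g + 1 : ℕ) : ℝ))
        (OnlineAllocation.netPoint ε (-((g + 1 : ℕ) : ℝ)) θ)) i
  refine ⟨fun S => OnlineAllocation.netPoint ε (-((g + 1 : ℕ) : ℝ)) (est S),
    fun S => OnlineAllocation.netPoint_mem_net _ _ _, fun D hpos hsmall => ?_⟩
  -- Without items T need not be positive, but the expected makespan is 0 and failure is impossible.
  rcases Nat.eq_zero_or_pos n with hn | hn
  · have hT := OnlineAllocation.expOpt_nonneg (by omega) hpos
    have hset : {S : Fin H → OnlineAllocation.WeightMatrix m n |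
        ¬ OnlineAllocation.expMakespan D (-((g + 1 : ℕ) : ℝ))
          (OnlineAllocation.netPoint ε (-((g + 1 : ℕ) : ℝ)) (est S)) ≤
          (1 + (200 + 1 / c) * ε) * OnlineAllocation.expOpt D} = ∅ := by
      refine Set.eq_empty_iff_forall_notMem.2 fun S hS => hS ?_
      rw [OnlineAllocation.expMakespan_eq_zero hn]
      positivity
    rw [hset, MeasureTheory.measure_empty]
    exact zero_le
  · have hlog : 0 < Real.log m := Real.log_pos (by exact_mod_cast hm)
    have hT := OnlineAllocation.expOpt_pos (by omega) hn (by positivity) hpos hsmall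
    rw [← MeasureTheory.ofReal_measureReal]
    refine ENNReal.ofReal_le_ofReal
      ((OnlineAllocation.sampleLaw_minimizer_le hm hε hε1 hc hg hK hest hpos hsmall hT).trans ?_)
    refine OnlineAllocation.union_bound_le hm hε hε1 hc ?_ hH
    rw [← hKdef]
    exact OnlineAllocation.floor_le_pow hm hε hε1
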